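/- Let $v_0=(0,0)$, $v_1=(1,0)$, $v_2=(\tfrac12,\tfrac{\sqrt3}{2})$ be the vertices of an equilateral triangle in $\mathbb R^2$, let $f$ be the linear contraction of $\mathbb R^2$ with fixed point $(0,0)$ and matrix $$\begin{pmatrix}\frac12&\frac{\sqrt3}{6}\\[2pt] \frac{\sqrt3}{12}&\frac14\end{pmatrix},$$ and let $f_1,\dots,f_6$ be the six affine contractions $g\circ f\circ g^{-1}$, where $g$ runs over the six symmetries of the triangle. The self-similar set of $f_1,\dots,f_6$ is the non-p.c.f. analog of the Sierpiński gasket. Its approximating (multi)graphs $G_n$, $n\ge 0$, are defined as follows. Let $V_0$ be the set of fixed points of the maps $f_i$ (so $V_0=\{v_0,v_1,v_2\}$), and for a word $w=i_1\cdots i_n\in\{1,\dots,6\}^n$ put $f_w=f_{i_1}\circ\cdots\circ f_{i_n}$. The vertex set of $G_n$ is $V_n=\bigcup_{|w|=n}f_w(V_0)$. The edges of $G_n$ are the pairs $(w,\{p,q\})$ with $w$ a word of length $n$ and $p\ne q$ in $V_0$, where $(w,\{p,q\})$ joins $f_w(p)$ to $f_w(q)$. Thus $G_0$ is the complete graph on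 $V_0$, and edges coming from different words are different edges, even if they have the same ends. Let $\tau(G_n)$ be the number of spanning trees of $G_n$. Then the asymptotic complexity constant of the sequence $(G_n)$ exists and $$\lim_{n\to\infty}\frac{\log\tau(G_n)}{|V_n|}=\frac{11\log 2}{10}+\frac{\log 3}{2}+\frac{\log 5}{5}.$$ -/

import Mathlib

open Filter Topology
open scoped Graph

/-! ### Spanning trees of multigraphs -/

namespace Graph

/-- A multigraph is connected if it has a vertex and any two vertices are joined by a walk. -/
def IsConnected {α β : Type*} (G : Graph α β) : Prop :=
  V(G).Nonempty ∧ ∀ x ∈ V(G), ∀ y ∈ V(G), Relation.ReflTransGen G.Adj x y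

/-- A multigraph is acyclic if it has no cycle `v 0, e 0, v 1, e 1, …, v k, e k, v 0` with distinct
vertices and distinct edges. A loop is a cycle of length one (`k = 0`), a pair of
parallel edges is a cycle of length two (`k = 1`); addition in `Fin (k + 1)` is cyclic. -/
def IsAcyclic {α β : Type*} (G : Graph α β) : Prop :=
  ∀ (k : ℕ) (v : Fin (k + 1) → α) (e : Fin (k + 1) → β),
    Function.Injective v → Function.Injective e → ¬ ∀ i, G.IsLink (e i) (v i) (v (i + 1))

/-- A tree is a connected acyclic multigraph. -/
def IsTree {α β : Type*} (G : Graph α β) : Prop :=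
  G.IsConnected ∧ G.IsAcyclic

/-- The complexity `τ(G)`: the number of spanning trees of `G`, that is, of subgraphs of `G` that
contain all the vertices of `G` and are trees. -/
noncomputable def complexity {α β : Type*} (G : Graph α β) : ℕ :=
  {T : Graph α β | T.IsSpanningSubgraph G ∧ T.IsTree}.ncard

/-- `c` is the asymptotic complexity constant (tree entropy) of the sequence `T` of finite
multigraphs: the limit of `log τ(T n) / |T n|` exists and equals `c`. -/
def IsAsymptoticComplexityConstant {α β : Type*} (T : ℕ → Graph α β) (c : ℝ) : Prop :=
  Tendsto (fun n => Real.log ((T n).complexity : ℝ) / (V(T n).ncard : ℝ)) atTop (𝓝 c)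

end Graph

/-! ### Approximating graphs of a self-similar structure -/

namespace SelfSimilar

/-- The boundary set `V₀`: the fixed points of the maps `f i`. -/
def boundary {ι X : Type*} (f : ι → X → X) : Set X :=
  {x | ∃ i, f i x = x}

/-- `wordMap f [i₁, …, iₙ] = f i₁ ∘ ⋯ ∘ f iₙ`. -/
def wordMap {ι X : Type*} (f : ι → X → X) : List ι → X → X
  | [] => id
  | i :: w => f i ∘ wordMap f w

/-- The level-`n` approximating multigraph `Gₙ`. Its vertex set `Vₙ` is the union of the sets
`f_w(V₀)` over the words `w` of length `n`; `G₀` is the complete graph on `V₀`, and each word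
`w` of length `n` contributes its own copy under `f_w` of every edge of `G₀`. The edge `(w, e)`
is the copy under `f_w` of the edge `e` of `G₀`; copies coming from distinct
words are distinct edges, even when they have the same ends. -/
def approxGraph {ι X : Type*} (f : ι → X → X) (n : ℕ) : Graph X (List ι × Sym2 X) where
  vertexSet := {x | ∃ w : List ι, w.length = n ∧ ∃ p ∈ boundary f, wordMap f w p = x}
  IsLink a x y := a.1.length = n ∧ ¬ a.2.IsDiag ∧ (∀ p ∈ a.2, p ∈ boundary f) ∧
    a.2.map (wordMap f a.1) = s(x, y)
  isLink_symm := by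
    intro a _
    exact ⟨fun x y h => ⟨h.1, h.2.1, h.2.2.1, h.2.2.2.trans Sym2.eq_swap⟩⟩
  eq_or_eq_of_isLink_of_isLink := by
    intro a x y v w h h'
    have h2 : s(x, y) = s(v, w) := h.2.2.2.symm.trans h'.2.2.2
    rcases Sym2.eq_iff.1 h2 with h3 | h3
    · exact Or.inl h3.1
    · exact Or.inr h3.1
  left_mem_of_isLink := by
    rintro a x y ⟨hn, -, hb, he⟩
    have hx : x ∈ a.2.map (wordMap f a.1) := he ▸ Sym2.mem_mk_left x y
    obtain ⟨p, hp, hpx⟩ := Sym2.mem_map.1 hx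
    exact ⟨a.1, hn, p, hb p hp, hpx⟩

end SelfSimilar

/-! ### The non-p.c.f. analog of the Sierpiński gasket -/

namespace NonPCFGasket

/-- The vertices of the equilateral triangle `(0,0)`, `(1,0)`, `(1/2, √3/2)`. -/
noncomputable def vertex : Fin 3 → EuclideanSpace ℝ (Fin 2) :=
  ![!₂[0, 0], !₂[1, 0], !₂[1 / 2, √3 / 2]]

/-- The barycentric coordinates of a point of the plane with respect to the triangle. -/
noncomputable def bary (p : EuclideanSpace ℝ (Fin 2)) : Fin 3 → ℝ :=
  ![1 - p 0 - p 1 / √3, p 0 - p 1 / √3, 2 * p 1 / √3]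

/-- The symmetry of the equilateral triangle that induces the permutation `σ` of its vertices. -/
noncomputable def triangleSymm (σ : Equiv.Perm (Fin 3)) (p : EuclideanSpace ℝ (Fin 2)) :
    EuclideanSpace ℝ (Fin 2) :=
  ∑ i, bary p i • vertex (σ i)

/-- The affine contraction with fixed point `(0,0)` and matrix
`(1/2, √3/6; √3/12, 1/4)`. It maps `(1/2, √3/2)` to the centre `(1/2, √3/6)` of the triangle and
`(1,0)` to the point `(1/2, √3/12)` of the axis of symmetry `x = 1/2`. -/
noncomputable def baseMap (p : EuclideanSpace ℝ (Fin 2)) : EuclideanSpace ℝ (Fin 2) :=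
  !₂[1 / 2 * p 0 + √3 / 6 * p 1, √3 / 12 * p 0 + 1 / 4 * p 1]

/-- The six contractions: the conjugates of `baseMap` by the six symmetries of the triangle. -/
noncomputable def contraction (σ : Equiv.Perm (Fin 3)) (p : EuclideanSpace ℝ (Fin 2)) :
    EuclideanSpace ℝ (Fin 2) :=
  triangleSymm σ (baseMap (triangleSymm σ⁻¹ p))

end NonPCFGasket

/-! ### The Cauchy–Binet formula -/

namespace Matrix

variable {m n R : Type*} [CommRing R] [Fintype m] [DecidableEq m] [Fintype n]

/-! Each step replaces every triangle by six: they share a centre, and two adjacent ones share an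
inner point on an axis of symmetry. All four new vertices lie in the open triangle, and distinct
cells of one level have disjoint interiors (`wordMap_eq_wordMap`). So a subdivision adds exactly
four new vertices per cell, and `5 |Vₙ| = 4 · 6 ^ n + 11`.

By the matrix-tree theorem (`complexity_eq_det`), `τ(Gₙ)` is the determinant of the Laplacian
grounded at one vertex. Eliminating the four inner vertices of a cell gives a factor `576` and
leaves, by symmetry, a multiple of the triangle Laplacian; the multiple is `5/4`. Hence `τ(Gₙ₊₁) =
576 ^ (6 ^ n) * (5/4) ^ (|Vₙ| - 1) * τ(Gₙ)` (`complexity_succ`). Taking logarithms and summing, the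
limit is `log 576 / 4 + log (5/4) / 5`. -/

theorem det_mul_transpose_eq_sum (M : Matrix m n R) :
    (M * Mᵀ).det = ∑ f : m → n, (∏ i, M i (f i)) * (M.submatrix id f).det := by
  have h : M * Mᵀ = fun i => ∑ j, M i j • Mᵀ j := by
    ext i k
    simp [mul_apply]
  have h2 := (detRowAlternating (n := m) (R := R)).toMultilinearMap.map_sum
    (fun i (j : n) => M i j • Mᵀ j)
  rw [h]
  refine h2.trans (Finset.sum_congr rfl fun f _ => ?_)
  rw [MultilinearMap.map_smul_univ, smul_eq_mul, ← det_transpose (M.submatrix id f)]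
  rfl

/-- The maps with the image of `g` are the `g ∘ σ` for permutations `σ`. Pulling the sign of `σ` out
of the minor leaves the Leibniz expansion of the other factor. -/
theorem sum_prod_mul_det_submatrix_of_image_eq [DecidableEq n] (M : Matrix m n R) (g : m → n)
    (hg : Function.Injective g) :
    ∑ f : m → n with Finset.univ.image f = Finset.univ.image g,
      (∏ i, M i (f i)) * (M.submatrix id f).det = (M.submatrix id g).det ^ 2 := by
  have key : ∑ σ : Equiv.Perm m, (∏ i, M i (g (σ i))) * (M.submatrix id (g ∘ σ)).det =
      (M.submatrix id g).det ^ 2 := by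
    have h : ∀ σ : Equiv.Perm m, (M.submatrix id (g ∘ σ)).det =
        (Equiv.Perm.sign σ : R) * (M.submatrix id g).det := fun σ =>
      det_permute' σ (M.submatrix id g)
    simp_rw [h]
    rw [sq]
    conv_rhs => enter [1]; rw [← det_transpose, det_apply']
    rw [Finset.sum_mul]
    refine Finset.sum_congr rfl fun σ _ => ?_
    simp only [transpose_apply, submatrix_apply, id]
    ring
  rw [← key]
  symm
  refine Finset.sum_bij (fun σ _ => g ∘ σ) ?_ ?_ ?_ ?_
  · intro σ _
    simp only [Finset.mem_filter, Finset.mem_univ, true_and]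
    rw [← Finset.image_image, Finset.image_univ_equiv]
  · intro σ _ τ _ h
    ext i
    exact hg (congrFun h i)
  · intro f hf
    simp only [Finset.mem_filter, Finset.mem_univ, true_and] at hf
    have hc : (Finset.univ.image f).card = Finset.univ.card (α := m) := by
      rw [hf, Finset.card_image_of_injective _ hg]
    have hf' : Function.Injective f := by
      have := Finset.card_image_iff.1 hc
      simpa using this
    have hex : ∀ i, ∃ j, g j = f i := fun i => by
      have : f i ∈ Finset.univ.image g := hf ▸ Finset.mem_image_of_mem f (Finset.mem_univ i)
      simpa using this
    choose σ hσ using hex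
    have hσi : Function.Injective σ := fun a b hab => hf' (by rw [← hσ a, ← hσ b, hab])
    refine ⟨Equiv.ofBijective σ ⟨hσi, Finite.surjective_of_injective hσi⟩, Finset.mem_univ _, ?_⟩
    ext i
    exact hσ i
  · intro σ _
    rfl

/-- A form of the Cauchy–Binet formula for matrices whose maximal minors are all `0` or `± 1`. -/
theorem det_mul_transpose_eq_card [DecidableEq n] (M : Matrix m n R) (P : Finset n → Prop)
    [DecidablePred P] (hP : ∀ f : m → n, Function.Injective f →
      (M.submatrix id f).det ^ 2 = if P (Finset.univ.image f) then 1 else 0) :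
    (M * Mᵀ).det =
      ((Finset.univ.filter fun S : Finset n => S.card = Fintype.card m ∧ P S).card : R) := by
  rw [det_mul_transpose_eq_sum,
    ← Finset.sum_fiberwise_of_maps_to (s := Finset.univ) (t := (Finset.univ : Finset (Finset n)))
      (g := fun f : m → n => Finset.univ.image f) (fun _ _ => Finset.mem_univ _),
    Finset.natCast_card_filter]
  refine Finset.sum_congr rfl fun S _ => ?_
  by_cases hS : S.card = Fintype.card m
  · have e : m ≃ S := Fintype.equivOfCardEq (by simp [hS])
    have hi : Function.Injective (fun i => (e i : n)) := Subtype.val_injective.comp e.injective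
    have him : Finset.univ.image (fun i => (e i : n)) = S := by
      ext x
      simp only [Finset.mem_image, Finset.mem_univ, true_and]
      refine ⟨?_, fun hx => ⟨e.symm ⟨x, hx⟩, by simp⟩⟩
      rintro ⟨i, rfl⟩
      exact (e i).2
    have := sum_prod_mul_det_submatrix_of_image_eq M _ hi
    rw [hP _ hi, him] at this
    rw [this]
    simp [hS]
  · rw [if_neg (fun h => hS h.1)]
    -- A map whose image has the wrong size repeats a column, so its minor vanishes.
    refine Finset.sum_eq_zero fun f hf => ?_
    have hf' : ¬ Function.Injective f := fun h => hS (by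
      rw [← (Finset.mem_filter.1 hf).2, Finset.card_image_of_injective _ h, Finset.card_univ])
    obtain ⟨i, j, hij, hne⟩ : ∃ i j, f i = f j ∧ i ≠ j := by
      simpa [Function.Injective] using hf'
    rw [det_zero_of_column_eq hne (fun k => by simp [hij]), mul_zero]

end Matrix

/-! ### The matrix-tree theorem for multigraphs -/

namespace Graph

/-- A multigraph is acyclic if and only if each of its edges is a bridge. -/
theorem isAcyclic_iff_forall_bridge {α β : Type*} (T : Graph α β) :
    T.IsAcyclic ↔ ∀ e x y, T.IsLink e x y →
      ¬ Relation.ReflTransGen (fun a b => ∃ e', e' ≠ e ∧ T.IsLink e' a b) x y := by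
  constructor
  · intro hT e x y hxy hr
    -- Without `e` and without loops, a walk can be shortened to a path with distinct vertices; `e`
    -- then closes it to a cycle, as its edge of last index.
    let H : SimpleGraph α := SimpleGraph.fromRel fun a b => ∃ e', e' ≠ e ∧ T.IsLink e' a b
    have hH : H.Reachable x y := by
      refine Relation.ReflTransGen.head_induction_on hr (SimpleGraph.Reachable.refl _) ?_
      intro a b hab _ ih
      by_cases h : a = b
      · exact h ▸ ih
      · exact SimpleGraph.Reachable.trans (SimpleGraph.Adj.reachable ⟨h, Or.inl hab⟩) ih
    have hHl : ∀ a b, H.Adj a b → ∃ e', e' ≠ e ∧ T.IsLink e' a b := by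
      rintro a b ⟨-, h | ⟨e', h, h'⟩⟩
      · exact h
      · exact ⟨e', h, h'.symm⟩
    obtain ⟨p, hp⟩ := hH.exists_isPath
    have hinj := hp.getVert_injOn
    have hex : ∀ i : Fin (p.length + 1), ∃ e' : β,
        T.IsLink e' (p.getVert i) (p.getVert (i + 1 : Fin (p.length + 1))) ∧
          (i ≠ Fin.last _ → e' ≠ e) ∧ (i = Fin.last _ → e' = e) := by
      intro i
      rcases Fin.eq_castSucc_or_eq_last i with ⟨j, rfl⟩ | rfl
      · obtain ⟨e', h, h'⟩ := hHl _ _ (p.adj_getVert_succ j.2)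
        refine ⟨e', ?_, fun _ => h, fun h => absurd h (Fin.castSucc_lt_last j).ne⟩
        simpa using h'
      · refine ⟨e, ?_, by simp, fun _ => rfl⟩
        simpa using hxy.symm
    choose ed hl hne heq using hex
    refine hT p.length (fun i => p.getVert i) ed ?_ ?_ hl
    · intro i j h
      exact Fin.ext (hinj (Nat.lt_succ_iff.1 i.2) (Nat.lt_succ_iff.1 j.2) h)
    · intro i j h
      by_cases hi : i = Fin.last _ <;> by_cases hj : j = Fin.last _
      · rw [hi, hj]
      · exact absurd (h ▸ heq i hi) (hne j hj)
      · exact absurd (h ▸ heq j hj) (hne i hi)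
      · obtain ⟨i, rfl⟩ := Fin.exists_castSucc_eq.2 hi
        obtain ⟨j, rfl⟩ := Fin.exists_castSucc_eq.2 hj
        have h1 := hl i.castSucc
        have h2 := hl j.castSucc
        rw [h] at h1
        have hi' := i.2
        have hj' := j.2
        rcases h1.eq_and_eq_or_eq_and_eq h2 with ⟨h3, -⟩ | ⟨h3, h4⟩
        · exact Fin.ext (hinj (by simp) (by simp) h3)
        -- One edge run through in both directions would force `i = j + 1` and `i + 1 = j`.
        · simp only [Fin.coeSucc_eq_succ, Fin.val_succ, Fin.val_castSucc] at h3 h4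
          have h5 := hinj (by simp) (by simp) h3
          have h6 := hinj (by simp) (by simp) h4
          lia
  · intro hT k v e _ he hl
    refine hT (e (Fin.last k)) (v (Fin.last k)) (v 0) (by simpa using hl (Fin.last k)) ?_
    have key : ∀ i : Fin (k + 1), Relation.ReflTransGen
        (fun a b => ∃ e', e' ≠ e (Fin.last k) ∧ T.IsLink e' a b) (v i) (v 0) := by
      intro i
      induction i using Fin.induction with
      | zero => exact .refl
      | succ i ih =>
        refine .head ⟨e i.castSucc, fun h => (Fin.castSucc_lt_last i).ne (he h), ?_⟩ ih
        simpa using (hl i.castSucc).symm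
    exact key _

/-! ### Incidence matrices and spanning trees -/

section Incidence

variable {V E : Type*} (s t : E → V)

/-- Two vertices are joined by an edge in `S`, where the edge `e` has the ends `s e` and `t e`. -/
def Step (S : Set E) (u v : V) : Prop :=
  ∃ e ∈ S, (s e = u ∧ t e = v) ∨ (s e = v ∧ t e = u)

variable {s t}

theorem Step.symm {S : Set E} {u v : V} (h : Step s t S u v) : Step s t S v u := by
  obtain ⟨e, he, h⟩ := h
  exact ⟨e, he, h.symm⟩

theorem Step.reflTransGen_symm {S : Set E} {u v : V} (h : Relation.ReflTransGen (Step s t S) u v) :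
    Relation.ReflTransGen (Step s t S) v u := by
  induction h with
  | refl => exact .refl
  | tail _ h ih => exact ih.head h.symm

variable (s t)

/-- The edges in `S` connect all the vertices. -/
def Connects (S : Set E) : Prop :=
  ∀ u v, Relation.ReflTransGen (Step s t S) u v

/-- The edges in `S` form a spanning tree. -/
def IsTreeOn (S : Set E) : Prop :=
  Connects s t S ∧ ∀ e ∈ S, ¬ Relation.ReflTransGen (Step s t (S \ {e})) (s e) (t e)

variable [DecidableEq V]

/-- The incidence matrix of a multigraph, with one more column for an edge that joins the
vertex `r` to the ground. -/
def rootedIncidence (r : V) : Matrix V (Option E) ℤ :=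
  Matrix.of fun v e => e.elim ((Pi.single r 1 : V → ℤ) v)
    fun e => (Pi.single (s e) 1 - Pi.single (t e) 1 : V → ℤ) v

variable {s t}

/-- The ground column is the basis vector of `r`, and adding or subtracting edge columns along a
walk moves it to any other vertex. The inverse is integral, so it yields both `det = ± 1` and rank
bounds. -/
theorem exists_rootedIncidence_mul_eq_one [Fintype V] {κ : Type*} [Fintype κ] [DecidableEq κ]
    (r : V) (f : κ → Option E)
    (hr : none ∈ Set.range f) (hc : Connects s t {e | some e ∈ Set.range f}) :
    ∃ P : Matrix κ V ℤ, (rootedIncidence s t r).submatrix id f * P = 1 := by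
  have hcol : ∀ k, ∃ x : κ → ℤ, ((rootedIncidence s t r).submatrix id f).mulVec x =
      fun v => rootedIncidence s t r v (f k) := fun k => ⟨Pi.single k 1, by
    ext v
    simp⟩
  have key : ∀ v, ∃ x : κ → ℤ, ((rootedIncidence s t r).submatrix id f).mulVec x =
      Pi.single v 1 := by
    intro v
    induction hc r v with
    | refl =>
      obtain ⟨k, hk⟩ := hr
      obtain ⟨x, hx⟩ := hcol k
      refine ⟨x, hx.trans ?_⟩
      ext v
      simp [hk, rootedIncidence]
    | tail _ h ih =>
      obtain ⟨e, ⟨k, hk⟩, h⟩ := h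
      obtain ⟨x, hx⟩ := hcol k
      obtain ⟨y, hy⟩ := ih
      rcases h with ⟨h1, h2⟩ | ⟨h1, h2⟩
      · refine ⟨y - x, ?_⟩
        rw [Matrix.mulVec_sub, hx, hy]
        ext v
        simp [hk, rootedIncidence, h1, h2]
      · refine ⟨y + x, ?_⟩
        rw [Matrix.mulVec_add, hx, hy]
        ext v
        simp [hk, rootedIncidence, h1, h2]
  choose x hx using key
  refine ⟨Matrix.of fun k v => x v k, ?_⟩
  ext u v
  have := congrFun (hx v) u
  rw [Matrix.one_apply]
  refine Eq.trans ?_ (this.trans (Pi.single_apply v (1 : ℤ) u))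
  rfl

theorem vecMul_rootedIncidence [Fintype V] (χ : V → ℤ) (r : V) {κ : Type*} (f : κ → Option E)
    (k : κ) : Matrix.vecMul χ ((rootedIncidence s t r).submatrix id f) k =
      (f k).elim (χ r) fun e => χ (s e) - χ (t e) := by
  cases h : f k <;>
    simp [Matrix.vecMul, dotProduct, rootedIncidence, h, Pi.single_apply, mul_sub,
      Finset.sum_sub_distrib]

open Classical in
-- In the connected case an integral right inverse makes the determinant a unit of `ℤ`. Otherwise a
-- nonzero row vector annihilates the matrix: the indicator of the vertices not reachable from `r`,
-- or the constant `1` if the ground column is missing.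
theorem det_rootedIncidence_sq [Fintype V] (r : V) (f : V → Option E) :
    ((rootedIncidence s t r).submatrix id f).det ^ 2 =
      if none ∈ Set.range f ∧ Connects s t {e | some e ∈ Set.range f} then 1 else 0 := by
  split_ifs with h
  · obtain ⟨P, hP⟩ := exists_rootedIncidence_mul_eq_one r f h.1 h.2
    have h2 := congrArg Matrix.det hP
    rw [Matrix.det_mul, Matrix.det_one] at h2
    have h3 := IsUnit.of_mul_eq_one _ h2
    rcases Int.isUnit_iff.1 h3 with h4 | h4 <;> simp [h4]
  · suffices h2 : ∃ χ : V → ℤ, χ ≠ 0 ∧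
        Matrix.vecMul χ ((rootedIncidence s t r).submatrix id f) = 0 by
      rw [Matrix.exists_vecMul_eq_zero_iff.1 h2, sq, mul_zero]
    by_cases hr : none ∈ Set.range f
    · have hc : ∃ v, ¬ Relation.ReflTransGen (Step s t {e | some e ∈ Set.range f}) r v := by
        by_contra! hc
        exact h ⟨hr, fun u v => (Step.reflTransGen_symm (hc u)).trans (hc v)⟩
      obtain ⟨v, hv⟩ := hc
      refine ⟨fun u => if Relation.ReflTransGen (Step s t {e | some e ∈ Set.range f}) r u
        then 0 else 1, fun h0 => ?_, ?_⟩
      · have h1 := congrFun h0 v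
        simp only [if_neg hv] at h1
        exact one_ne_zero h1
      · ext k
        rw [vecMul_rootedIncidence]
        cases hk : f k with
        | none => simp [Relation.ReflTransGen.refl]
        | some e =>
          have h1 : Step s t {e | some e ∈ Set.range f} (s e) (t e) :=
            ⟨e, ⟨k, hk⟩, Or.inl ⟨rfl, rfl⟩⟩
          have h2 : Relation.ReflTransGen (Step s t {e | some e ∈ Set.range f}) r (s e) ↔
              Relation.ReflTransGen (Step s t {e | some e ∈ Set.range f}) r (t e) :=
            ⟨fun h => h.tail h1, fun h => h.tail h1.symm⟩
          simp only [h2, Option.elim_some, sub_self, Pi.zero_apply]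
    · refine ⟨1, fun h0 => ?_, ?_⟩
      · simpa using congrFun h0 r
      · ext k
        rw [vecMul_rootedIncidence]
        cases hk : f k with
        | none => exact absurd ⟨k, hk⟩ hr
        | some e => simp

theorem range_optionMap_val (S : Finset E) :
    none ∈ Set.range (Option.map (Subtype.val : S → E)) ∧
      {e | some e ∈ Set.range (Option.map (Subtype.val : S → E))} = (S : Set E) := by
  refine ⟨⟨none, rfl⟩, ?_⟩
  ext e
  simp [Option.exists]

/-- A matrix with `|S| + 1` columns and a right inverse has rank `|V|`. -/
theorem Connects.card_le [Fintype V] [Nonempty V] {S : Finset E} (h : Connects s t (S : Set E)) :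
    Fintype.card V ≤ S.card + 1 := by
  classical
  obtain ⟨h1, h2⟩ := range_optionMap_val S
  obtain ⟨P, hP⟩ := exists_rootedIncidence_mul_eq_one (s := s) (t := t) (Classical.arbitrary V)
    _ h1 (h2 ▸ h)
  have h3 := Matrix.rank_mul_le_left ((rootedIncidence s t (Classical.arbitrary V)).submatrix id
    (Option.map (Subtype.val : S → E))) P
  rw [hP, Matrix.rank_one] at h3
  refine (h3.trans (Matrix.rank_le_card_width _)).trans ?_
  simp

theorem IsTreeOn.card_le [Fintype V] [Nonempty V] {S : Finset E} (h : IsTreeOn s t (S : Set E)) :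
    S.card + 1 ≤ Fintype.card V := by
  classical
  let r := Classical.arbitrary V
  let N := (rootedIncidence s t r).submatrix id (Option.map (Subtype.val : S → E))
  let χ (e : E) (v : V) : ℤ :=
    if Relation.ReflTransGen (Step s t ((S : Set E) \ {e})) (s e) v then 1 else 0
  -- A left inverse of `N`: the row of an edge `e` indicates the side of `s e` once the bridge `e`
  -- is cut, shifted to vanish at `r`; the ground row is constant.
  let Q : Matrix (Option S) V ℤ :=
    Matrix.of fun k => k.elim 1 fun e v => χ e v - χ e r
  have hχ : ∀ e e' : S, e' ≠ e → χ e (s e') = χ e (t e') := by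
    intro e e' hne
    have h1 : Step s t ((S : Set E) \ {e.1}) (s e') (t e') :=
      ⟨e', ⟨e'.2, fun h => hne (Subtype.ext h)⟩, Or.inl ⟨rfl, rfl⟩⟩
    have h2 : Relation.ReflTransGen (Step s t ((S : Set E) \ {e.1})) (s e) (s e') ↔
        Relation.ReflTransGen (Step s t ((S : Set E) \ {e.1})) (s e) (t e') :=
      ⟨fun h => h.tail h1, fun h => h.tail h1.symm⟩
    simp [χ, h2]
  have hχ' : ∀ e : S, χ e (s e) = 1 ∧ χ e (t e) = 0 := fun e =>
    ⟨if_pos .refl, if_neg (h.2 e e.2)⟩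
  have hQ : Q * N = 1 := by
    ext k l
    have h1 : (Q * N) k l = Matrix.vecMul (Q k) N l := rfl
    rw [h1, vecMul_rootedIncidence]
    cases k with
    | none => cases l <;> simp [Q]
    | some e =>
      cases l with
      | none => simp [Q]
      | some e' =>
        by_cases hee : e' = e
        · subst hee
          simp [Q, hχ']
        · simp [Q, hχ e e' hee, Ne.symm hee]
  have h3 := Matrix.rank_mul_le_left Q N
  rw [hQ, Matrix.rank_one] at h3
  have h4 := h3.trans (Matrix.rank_le_card_width _)
  simpa using h4

theorem isTreeOn_iff [Fintype V] [Nonempty V] {S : Finset E} :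
    IsTreeOn s t (S : Set E) ↔ Connects s t (S : Set E) ∧ S.card + 1 = Fintype.card V := by
  classical
  refine ⟨fun h => ⟨h.1, le_antisymm h.card_le h.1.card_le⟩, fun h => ⟨h.1, fun e he hr => ?_⟩⟩
  -- An edge that is not a bridge could be erased, leaving too few edges to connect `V`.
  have h1 : Connects s t ((S.erase e : Finset E) : Set E) := by
    intro u v
    rw [Finset.coe_erase]
    refine Relation.ReflTransGen.trans_induction_on (h.1 u v) (fun _ => .refl) ?_
      (fun _ _ => .trans)
    rintro a b ⟨e', he', h⟩
    by_cases hee : e' = e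
    · subst hee
      rcases h with ⟨rfl, rfl⟩ | ⟨rfl, rfl⟩
      · exact hr
      · exact Step.reflTransGen_symm hr
    · exact .single ⟨e', ⟨he', hee⟩, h⟩
  have h2 := h1.card_le
  have h3 := Finset.card_erase_add_one (Finset.mem_coe.1 he)
  lia

open Classical in
/-- The number of spanning trees as the determinant of a Laplacian grounded at `r`. -/
theorem det_rootedIncidence_mul_transpose [Fintype V] [Fintype E] (r : V) :
    (rootedIncidence s t r * (rootedIncidence s t r).transpose).det =
      ((Finset.univ.filter fun S : Finset E => IsTreeOn s t (S : Set E)).card : ℤ) := by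
  have : Nonempty V := ⟨r⟩
  rw [Matrix.det_mul_transpose_eq_card _
    (fun T => none ∈ T ∧ Connects s t ((Finset.eraseNone T : Finset E) : Set E))]
  · congr 1
    refine Finset.card_nbij' Finset.eraseNone Finset.insertNone ?_ ?_ ?_ ?_
    · intro T hT
      simp only [Finset.coe_filter, Finset.mem_univ, true_and, Set.mem_ofPred_eq] at hT ⊢
      refine isTreeOn_iff.2 ⟨hT.2.2, ?_⟩
      rw [← hT.1, ← Finset.card_insertNone, Finset.insertNone_eraseNone,
        Finset.insert_eq_of_mem hT.2.1]
    · intro S hS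
      simp only [Finset.coe_filter, Finset.mem_univ, true_and, Set.mem_ofPred_eq] at hS ⊢
      refine ⟨?_, by simp, by simpa using hS.1⟩
      rw [Finset.card_insertNone, (isTreeOn_iff.1 hS).2]
    · intro T hT
      simp only [Finset.coe_filter, Finset.mem_univ, true_and, Set.mem_ofPred_eq] at hT
      rw [Finset.insertNone_eraseNone, Finset.insert_eq_of_mem hT.2.1]
    · intro S _
      simp
  · intro f _
    rw [det_rootedIncidence_sq]
    have h1 : none ∈ Finset.univ.image f ↔ none ∈ Set.range f := by simp
    have h2 : ((Finset.eraseNone (Finset.univ.image f) : Finset E) : Set E) =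
        {e | some e ∈ Set.range f} := by
      ext e
      simp
    simp only [h1, h2]

end Incidence

/-- A description of a finite multigraph by its vertices `φ v`, its edges `ε e` and the ends
`φ (s e)` and `φ (t e)` of each edge. -/
structure Presentation {α β : Type*} (G : Graph α β) (V E : Type*) where
  φ : V → α
  ε : E → β
  s : E → V
  t : E → V
  φ_injective : Function.Injective φ
  range_φ : Set.range φ = V(G)
  ε_injective : Function.Injective ε
  range_ε : Set.range ε = E(G)
  isLink : ∀ e, G.IsLink (ε e) (φ (s e)) (φ (t e))

namespace Presentation

variable {α β V E : Type*} {G : Graph α β} (p : G.Presentation V E)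

theorem isLink_restrict_iff (S : Set E) (e : E) (u v : V) :
    (G.restrict (p.ε '' S)).IsLink (p.ε e) (p.φ u) (p.φ v) ↔
      e ∈ S ∧ ((p.s e = u ∧ p.t e = v) ∨ (p.s e = v ∧ p.t e = u)) := by
  rw [Graph.restrict_isLink, p.ε_injective.mem_set_image, (p.isLink e).isLink_iff]
  simp only [p.φ_injective.eq_iff]

/-- Walks can be pulled back along `φ` because every vertex reached lies in `V(G)`, the range of
`φ`. -/
theorem reflTransGen_iff (R : α → α → Prop) (R' : V → V → Prop)
    (h : ∀ x y, R x y → y ∈ V(G)) (hR : ∀ u v, R (p.φ u) (p.φ v) ↔ R' u v) (u v : V) :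
    Relation.ReflTransGen R (p.φ u) (p.φ v) ↔ Relation.ReflTransGen R' u v := by
  refine ⟨fun hr => ?_, fun hr => hr.lift p.φ fun a b hab => (hR a b).2 hab⟩
  generalize hy : p.φ v = y at hr
  induction hr generalizing v with
  | refl => rw [p.φ_injective hy]
  | tail h1 h2 ih =>
    rename_i a b
    have ha : ∃ w, p.φ w = a := by
      rcases Relation.ReflTransGen.cases_tail h1 with h3 | ⟨c, -, h3⟩
      · exact ⟨u, h3.symm⟩
      · exact (p.range_φ ▸ h _ _ h3 : a ∈ Set.range p.φ)
    obtain ⟨w, rfl⟩ := ha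
    subst hy
    exact (ih w rfl).tail ((hR _ _).1 h2)

theorem isTree_restrict_iff [Nonempty V] (S : Set E) :
    (G.restrict (p.ε '' S)).IsTree ↔ IsTreeOn p.s p.t S := by
  have hE : ∀ e x y, (G.restrict (p.ε '' S)).IsLink e x y → ∃ e', p.ε e' = e := by
    rintro e x y ⟨⟨e', -, h⟩, -⟩
    exact ⟨e', h⟩
  have hV : ∀ x ∈ V(G), ∃ v, p.φ v = x := fun x hx => (p.range_φ ▸ hx : x ∈ Set.range p.φ)
  have hV' : ∀ v, p.φ v ∈ V(G) := fun v => p.range_φ ▸ Set.mem_range_self v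
  rw [IsTree, isAcyclic_iff_forall_bridge, IsTreeOn, IsConnected]
  refine and_congr ?_ ?_
  · have key : ∀ u v, Relation.ReflTransGen (G.restrict (p.ε '' S)).Adj (p.φ u) (p.φ v) ↔
        Relation.ReflTransGen (Step p.s p.t S) u v := by
      refine p.reflTransGen_iff _ _ (fun x y h => h.right_mem) fun u v => ?_
      constructor
      · rintro ⟨e, he⟩
        obtain ⟨e, rfl⟩ := hE _ _ _ he
        exact ⟨e, (p.isLink_restrict_iff S e u v).1 he⟩
      · rintro ⟨e, he⟩
        exact ⟨p.ε e, (p.isLink_restrict_iff S e u v).2 he⟩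
    constructor
    · rintro ⟨-, h⟩ u v
      exact (key u v).1 (h _ (hV' u) _ (hV' v))
    · refine fun h => ⟨⟨_, hV' (Classical.arbitrary V)⟩, fun x hx y hy => ?_⟩
      obtain ⟨u, rfl⟩ := hV x hx
      obtain ⟨v, rfl⟩ := hV y hy
      exact (key u v).2 (h u v)
  · have key : ∀ e u v, Relation.ReflTransGen (fun a b => ∃ e', e' ≠ p.ε e ∧
        (G.restrict (p.ε '' S)).IsLink e' a b) (p.φ u) (p.φ v) ↔
        Relation.ReflTransGen (Step p.s p.t (S \ {e})) u v := by
      intro e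
      refine p.reflTransGen_iff _ _ (fun x y ⟨_, _, h⟩ => h.right_mem) fun u v => ?_
      constructor
      · rintro ⟨e', hne, he⟩
        obtain ⟨e', rfl⟩ := hE _ _ _ he
        have h := (p.isLink_restrict_iff S e' u v).1 he
        exact ⟨e', ⟨h.1, fun h => hne (congrArg p.ε h)⟩, h.2⟩
      · rintro ⟨e', ⟨he, hne⟩, h⟩
        exact ⟨p.ε e', p.ε_injective.ne hne, (p.isLink_restrict_iff S e' u v).2 ⟨he, h⟩⟩
    constructor
    · intro h e he hr
      exact h (p.ε e) _ _ ((p.isLink_restrict_iff S e (p.s e) (p.t e)).2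
        ⟨he, Or.inl ⟨rfl, rfl⟩⟩) ((key e _ _).2 hr)
    · intro h e x y hl hr
      obtain ⟨e, rfl⟩ := hE _ _ _ hl
      obtain ⟨u, rfl⟩ := hV x hl.left_mem
      obtain ⟨v, rfl⟩ := hV y hl.right_mem
      obtain ⟨he, ⟨h1, h2⟩ | ⟨h1, h2⟩⟩ := (p.isLink_restrict_iff S e u v).1 hl
      · exact h e he (h1 ▸ h2 ▸ (key e u v).1 hr)
      · exact h e he (h1 ▸ h2 ▸ Step.reflTransGen_symm ((key e u v).1 hr))

/-- The matrix-tree theorem for multigraphs. -/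
theorem complexity_eq_det [Fintype V] [DecidableEq V] [Fintype E] (r : V) :
    (G.complexity : ℤ) =
      (rootedIncidence p.s p.t r * (rootedIncidence p.s p.t r).transpose).det := by
  classical
  have : Nonempty V := ⟨r⟩
  have h : {T : Graph α β | T.IsSpanningSubgraph G ∧ T.IsTree} =
      (fun S : Finset E => G.restrict (p.ε '' (S : Set E))) ''
        ((Finset.univ.filter fun S : Finset E => IsTreeOn p.s p.t (S : Set E) :
          Finset (Finset E)) : Set (Finset E)) := by
    ext T
    simp only [Set.mem_ofPred_eq, Set.mem_image, Finset.coe_filter, Finset.mem_univ, true_and]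
    constructor
    · rintro ⟨hT, hT'⟩
      -- A spanning subgraph is determined by its edge set.
      have h1 : T = G.restrict (p.ε '' ((Finset.univ.filter fun e => p.ε e ∈ E(T) :
          Finset E) : Set E)) := by
        have h2 : p.ε '' ((Finset.univ.filter fun e => p.ε e ∈ E(T) : Finset E) : Set E) =
            E(T) := by
          ext b
          simp only [Set.mem_image, Finset.coe_filter, Finset.mem_univ, true_and,
            Set.mem_ofPred_eq]
          constructor
          · rintro ⟨e, he, rfl⟩
            exact he
          · intro hb
            obtain ⟨e, rfl⟩ : b ∈ Set.range p.ε := p.range_ε ▸ hT.le.edgeSet_mono hb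
            exact ⟨e, hb, rfl⟩
        rw [h2]
        refine Graph.ext hT.vertexSet_eq fun e x y => ?_
        rw [Graph.restrict_isLink]
        constructor
        · exact fun h => ⟨h.edge_mem, h.mono hT.le⟩
        · exact fun h => (hT.le.isLink_iff h.1).2 h.2
      refine ⟨_, ?_, h1.symm⟩
      rw [← p.isTree_restrict_iff, ← h1]
      exact hT'
    · rintro ⟨S, hS, rfl⟩
      exact ⟨⟨Graph.restrict_le, rfl⟩, (p.isTree_restrict_iff _).2 hS⟩
  rw [det_rootedIncidence_mul_transpose, complexity, h, Set.ncard_image_of_injective,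
    Set.ncard_coe_finset]
  intro S S' hSS
  have h1 : ∀ S : Finset E, E(G.restrict (p.ε '' (S : Set E))) = p.ε '' (S : Set E) := fun S => by
    rw [Graph.edgeSet_restrict, ← p.range_ε, Set.inter_eq_right]
    exact Set.image_subset_range _ _
  have h2 := congrArg Graph.edgeSet hSS
  simp only [h1] at h2
  exact Finset.coe_injective (p.ε_injective.image_injective h2)

end Presentation

end Graph

/-! ### Laplacians assembled from copies of one matrix -/

namespace Matrix

section OneHot

variable {J J' V W W' R : Type*} [CommRing R]

/-- The matrix of the linear map that sends the basis vector of `j` to that of `g j`. -/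
def oneHot (R : Type*) [CommRing R] [DecidableEq V] (g : J → V) : Matrix V J R :=
  of fun v j => if v = g j then 1 else 0

theorem oneHot_comp [DecidableEq V] [Fintype J'] [DecidableEq J'] (g : J' → V) (h : J → J') :
    oneHot R (g ∘ h) = oneHot R g * oneHot R h := by
  ext v j
  simp [oneHot, mul_apply]

theorem transpose_oneHot_mulVec_one [DecidableEq V] [Fintype V] (g : J → V) :
    (oneHot R g)ᵀ *ᵥ 1 = 1 := by
  ext j
  simp [oneHot, mulVec, dotProduct]

/-- The sum of copies of the matrix `K`, where the copy of index `w` is placed at the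
positions `p w j`. -/
def assemble [DecidableEq V] [Fintype W] [Fintype J] (p : W → J → V) (K : Matrix J J R) :
    Matrix V V R :=
  ∑ w, oneHot R (p w) * K * (oneHot R (p w))ᵀ

variable [DecidableEq V] [Fintype W] [Fintype J]

theorem assemble_map {R' : Type*} [CommRing R'] (f : R →+* R') (p : W → J → V)
    (K : Matrix J J R) : (assemble p K).map f = assemble p (K.map f) := by
  ext u v
  simp [assemble, sum_apply, mul_apply, oneHot, apply_ite f]

theorem assemble_smul (c : R) (p : W → J → V) (K : Matrix J J R) :
    assemble p (c • K) = c • assemble p K := by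
  simp [assemble, Finset.smul_sum]

/-- Assembly in two stages: the Laplacian of the subdivided graph is assembled from one gadget
Laplacian per old cell. -/
theorem assemble_comp [Fintype W'] [Fintype J'] [DecidableEq J'] (g : W' → J' → V)
    (h : W → J → J') (K : Matrix J J R) :
    assemble (fun x : W' × W => g x.1 ∘ h x.2) K = assemble g (assemble h K) := by
  simp only [assemble, Fintype.sum_prod_type, oneHot_comp, Matrix.mul_sum, Matrix.sum_mul,
    transpose_mul, Matrix.mul_assoc]

theorem assemble_mulVec_one [Fintype V] (p : W → J → V) (K : Matrix J J R)
    (hK : K *ᵥ 1 = 0) : assemble p K *ᵥ 1 = 0 := by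
  simp only [assemble, sum_mulVec, ← mulVec_mulVec, transpose_oneHot_mulVec_one, hK, mulVec_zero,
    Finset.sum_const_zero]

end OneHot

/-! ### Scaling of grounded Laplacians -/

section Grounded

variable {V K : Type*} [Field K] [Fintype V] [DecidableEq V]

/-- The determinant is affine in `c` through column `r`, and its constant term `det X` is zero. -/
theorem det_add_single_of_mulVec_one (X : Matrix V V K) (hX : X *ᵥ 1 = 0) (r : V) (c : K) :
    (X + single r r c).det = c * (X + single r r 1).det := by
  have h0 : X.det = 0 := exists_mulVec_eq_zero_iff.1 ⟨1, fun h => one_ne_zero (congrFun h r), hX⟩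
  have h1 : ∀ c : K, X + single r r c = X.updateCol r ((fun i => X i r) + c • Pi.single r 1) := by
    intro c
    ext i j
    by_cases hj : j = r
    · subst hj
      by_cases hi : i = j
      · subst hi; simp
      · simp [hi, Ne.symm hi]
    · simp [hj, Ne.symm hj]
  have h2 : ∀ c : K, (X + single r r c).det = c * (X.updateCol r (Pi.single r 1)).det := by
    intro c
    rw [h1, det_updateCol_add, det_updateCol_smul, updateCol_eq_self, h0, zero_add]
  rw [h2 c, h2 1, one_mul]

/-- Taking `c` out of the whole matrix gives `c ^ |V|`, but the ground entry becomes `c⁻¹`, which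
costs one power. -/
theorem det_smul_add_single_of_mulVec_one (X : Matrix V V K) (hX : X *ᵥ 1 = 0) (r : V) {c : K}
    (hc : c ≠ 0) :
    (c • X + single r r 1).det = c ^ (Fintype.card V - 1) * (X + single r r 1).det := by
  have h1 : c • X + single r r 1 = c • (X + single r r c⁻¹) := by
    rw [smul_add, smul_single, smul_eq_mul, mul_inv_cancel₀ hc]
  have h2 : Fintype.card V = Fintype.card V - 1 + 1 :=
    (Nat.sub_add_cancel (Fintype.card_pos_iff.2 ⟨r⟩)).symm
  rw [h1, det_smul, det_add_single_of_mulVec_one X hX]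
  conv_lhs => rw [h2, pow_succ]
  field_simp

end Grounded

/-! ### Elimination of inner vertices -/

section Schur

variable {V W J₁ J₂ K : Type*} [Field K] [Fintype V] [DecidableEq V] [Fintype W] [DecidableEq W]
  [Fintype J₁] [Fintype J₂] [DecidableEq J₂]

theorem oneHot_sumMap {V₁ V₂ I₁ I₂ : Type*} [DecidableEq V₁] [DecidableEq V₂] (g : I₁ → V₁)
    (h : I₂ → V₂) :
    oneHot K (Sum.map g h) = fromBlocks (oneHot K g) 0 0 (oneHot K h) := by
  ext (i | i) (j | j) <;> simp [oneHot]

theorem transpose_oneHot_mul_oneHot (w w' : W) :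
    (oneHot K fun k : J₂ => (k, w))ᵀ * (oneHot K fun k : J₂ => (k, w')) =
      if w = w' then 1 else 0 := by
  ext i j
  by_cases h : w = w'
  · subst h
    simp [mul_apply, oneHot, one_apply, eq_comm]
  · simp [mul_apply, oneHot, h, Ne.symm h]

theorem sum_oneHot_mul_mul_transpose (D : Matrix J₂ J₂ K) :
    ∑ w : W, oneHot K (fun k : J₂ => (k, w)) * D * (oneHot K fun k : J₂ => (k, w))ᵀ =
      blockDiagonal fun _ => D := by
  ext ⟨i, w⟩ ⟨j, w'⟩
  simp [sum_apply, mul_apply, oneHot, blockDiagonal_apply, ite_and, Finset.sum_ite_eq]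

/-- Elimination of the inner vertices of all the copies of a matrix in block form. -/
theorem det_assemble_fromBlocks (cell : W → J₁ → V) (A : Matrix J₁ J₁ K) (B : Matrix J₁ J₂ K)
    (D D' : Matrix J₂ J₂ K) (hD : D' * D = 1) (r : V) :
    (assemble (fun w => Sum.map (cell w) fun k : J₂ => (k, w)) (fromBlocks A B Bᵀ D) +
      single (Sum.inl r) (Sum.inl r) 1).det =
      D.det ^ Fintype.card W * (assemble cell (A - B * D' * Bᵀ) + single r r 1).det := by
  have hD2 : D * D' = 1 := mul_eq_one_comm.1 hD
  let H (w : W) : Matrix V J₁ K := oneHot K (cell w)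
  let I (w : W) : Matrix (J₂ × W) J₂ K := oneHot K fun k : J₂ => (k, w)
  -- Different copies share no inner vertex, so all cross terms of the Schur complement vanish.
  have hI : ∀ w w', (I w)ᵀ * I w' = if w = w' then 1 else 0 := transpose_oneHot_mul_oneHot
  let X : Matrix V (J₂ × W) K := ∑ w, H w * B * (I w)ᵀ
  let Y : Matrix (J₂ × W) V K := ∑ w, I w * Bᵀ * (H w)ᵀ
  let : Invertible (blockDiagonal fun _ : W => D) :=
    ⟨blockDiagonal fun _ => D', by rw [← blockDiagonal_mul, hD]; exact blockDiagonal_one,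
      by rw [← blockDiagonal_mul, hD2]; exact blockDiagonal_one⟩
  have h1 : assemble (fun w => Sum.map (cell w) fun k : J₂ => (k, w)) (fromBlocks A B Bᵀ D) +
      single (Sum.inl r) (Sum.inl r) 1 =
      fromBlocks (assemble cell A + single r r 1) X Y (blockDiagonal fun _ => D) := by
    rw [← sum_oneHot_mul_mul_transpose]
    have h2 : ∀ w, oneHot K (Sum.map (cell w) fun k : J₂ => (k, w)) * fromBlocks A B Bᵀ D *
        (oneHot K (Sum.map (cell w) fun k : J₂ => (k, w)))ᵀ =
        fromBlocks (H w * A * (H w)ᵀ) (H w * B * (I w)ᵀ) (I w * Bᵀ * (H w)ᵀ)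
          (I w * D * (I w)ᵀ) := by
      intro w
      simp [oneHot_sumMap, fromBlocks_multiply, fromBlocks_transpose, H, I]
    simp only [assemble, h2]
    ext (i | i) (j | j) <;> simp [sum_apply, single_apply, H, I, X, Y]
  have h3 : X * (blockDiagonal fun _ : W => D') * Y =
      assemble cell (B * D' * Bᵀ) := by
    rw [← sum_oneHot_mul_mul_transpose]
    have h4 : ∀ w₁ w₂ w₃ : W, H w₁ * B * (I w₁)ᵀ * (I w₂ * D' * (I w₂)ᵀ) * (I w₃ * Bᵀ * (H w₃)ᵀ) =
        if w₁ = w₂ then if w₂ = w₃ then H w₁ * (B * D' * Bᵀ) * (H w₁)ᵀ else 0 else 0 := by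
      intro w₁ w₂ w₃
      have : H w₁ * B * (I w₁)ᵀ * (I w₂ * D' * (I w₂)ᵀ) * (I w₃ * Bᵀ * (H w₃)ᵀ) =
          H w₁ * B * ((I w₁)ᵀ * I w₂) * D' * ((I w₂)ᵀ * I w₃) * Bᵀ * (H w₃)ᵀ := by
        simp only [Matrix.mul_assoc]
      rw [this, hI, hI]
      split_ifs with h h'
      · subst h; subst h'
        simp only [Matrix.mul_assoc, Matrix.one_mul]
      · simp
      · simp
      · simp
    change X * (∑ w, I w * D' * (I w)ᵀ) * Y = _
    simp only [X, Y, Matrix.sum_mul, Matrix.mul_sum, h4]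
    simp [assemble, H]
  rw [h1, det_fromBlocks₂₂]
  have h5 : ⅟(blockDiagonal fun _ : W => D) = blockDiagonal fun _ => D' := rfl
  rw [h5, h3, det_blockDiagonal, Finset.prod_const, Finset.card_univ]
  congr 2
  have h6 : assemble cell (A - B * D' * Bᵀ) = assemble cell A - assemble cell (B * D' * Bᵀ) := by
    simp [assemble, Matrix.mul_sub, Matrix.sub_mul]
  rw [h6]
  abel

end Schur

end Matrix

/-! ### Subdivision of triangles -/

namespace NonPCFGasket

open Matrix

/-- The Laplacian of the complete graph on three vertices. -/
def triangleLaplacian : Matrix (Fin 3) (Fin 3) ℤ :=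
  !![2, -1, -1; -1, 2, -1; -1, -1, 2]

/-- The three vertices of the piece `σ` of a subdivided triangle. The old vertices are
`Sum.inl i`, the centre is `Sum.inr 3` and the new vertex opposite to `k` is `Sum.inr k`. -/
def gadget (σ : Equiv.Perm (Fin 3)) (j : Fin 3) : Fin 3 ⊕ Fin 4 :=
  if σ 0 = j then Sum.inl j else if σ 1 = j then Sum.inr (σ 2).castSucc else Sum.inr 3

/-- The old vertices are pairwise non-adjacent and each lies in two pieces, hence the block `4`.
Entries `-2` come from sides common to two pieces; the centre lies in all six. -/
theorem assemble_gadget : assemble gadget triangleLaplacian =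
    fromBlocks (4 : Matrix (Fin 3) (Fin 3) ℤ)
      !![0, -1, -1, -2; -1, 0, -1, -2; -1, -1, 0, -2]
      (!![0, -1, -1, -2; -1, 0, -1, -2; -1, -1, 0, -2] : Matrix (Fin 3) (Fin 4) ℤ)ᵀ
      !![4, 0, 0, -2; 0, 4, 0, -2; 0, 0, 4, -2; -2, -2, -2, 12] := by
  decide +kernel

variable {V W : Type*}

/-- The pieces of the subdivided triangles. -/
def subdivide (cell : W → Fin 3 → V) (x : W × Equiv.Perm (Fin 3)) : Fin 3 → V ⊕ Fin 4 × W :=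
  Sum.map (cell x.1) (fun k => (k, x.1)) ∘ gadget x.2

variable [DecidableEq V] [Fintype W]

theorem rootedIncidence_mul_transpose (cell : W → Fin 3 → V) (r : V) :
    Graph.rootedIncidence (fun e : W × Fin 3 => cell e.1 e.2) (fun e => cell e.1 (e.2 + 1)) r *
      (Graph.rootedIncidence (fun e : W × Fin 3 => cell e.1 e.2)
        (fun e => cell e.1 (e.2 + 1)) r)ᵀ =
      assemble cell triangleLaplacian + single r r 1 := by
  ext u v
  have h : ∀ r : V, (Pi.single r 1 : V → ℤ) u * (Pi.single r 1 : V → ℤ) v =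
      single r r (1 : ℤ) u v := fun r => by
    simp [single_apply, Pi.single_apply, ← ite_and, eq_comm, and_comm]
  simp only [mul_apply, transpose_apply, Fintype.sum_option, Graph.rootedIncidence, of_apply,
    Option.elim_none, Option.elim_some, h, Matrix.add_apply, assemble, Matrix.sum_apply,
    Fintype.sum_prod_type]
  rw [add_comm]
  congr 1
  refine Finset.sum_congr rfl fun w _ => ?_
  simp only [Fin.sum_univ_three, oneHot, of_apply, triangleLaplacian, Pi.sub_apply,
    Pi.single_apply, show (0 : Fin 3) + 1 = 1 from rfl, show (1 : Fin 3) + 1 = 2 from rfl,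
    show (2 : Fin 3) + 1 = 0 from rfl]
  -- What remains is a polynomial identity in the six indicators, valid even if corners coincide.
  generalize (if u = cell w 0 then (1 : ℤ) else 0) = a₀
  generalize (if u = cell w 1 then (1 : ℤ) else 0) = a₁
  generalize (if u = cell w 2 then (1 : ℤ) else 0) = a₂
  generalize (if v = cell w 0 then (1 : ℤ) else 0) = b₀
  generalize (if v = cell w 1 then (1 : ℤ) else 0) = b₁
  generalize (if v = cell w 2 then (1 : ℤ) else 0) = b₂
  simp
  ring

variable [Fintype V]

theorem intCast_det_assemble_add_single {J : Type*} [Fintype J] (p : W → J → V)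
    (K : Matrix J J ℤ) (r : V) : ((assemble p K + single r r 1).det : ℚ) =
      (assemble p (K.map (Int.castRingHom ℚ)) + single r r 1).det := by
  have h := (Int.castRingHom ℚ).map_det (assemble p K + single r r 1)
  rw [RingHom.mapMatrix_apply, Matrix.map_add _ (map_add _), assemble_map, map_single, map_one] at h
  exact h

/-- Each cell contributes `det D = 576`, and its Schur complement is `5/4` times the triangle
Laplacian. Rational entries are needed for the inverse `D'` of `D`. -/
theorem det_subdivide [DecidableEq W] (cell : W → Fin 3 → V) (r : V) :
    ((assemble (subdivide cell) triangleLaplacian + single (Sum.inl r) (Sum.inl r) 1).det : ℚ) =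
      576 ^ Fintype.card W * (5 / 4) ^ (Fintype.card V - 1) *
        ((assemble cell triangleLaplacian + single r r 1).det : ℚ) := by
  have h1 : assemble (subdivide cell) triangleLaplacian =
      assemble (fun w => Sum.map (cell w) fun k => (k, w))
        (assemble gadget triangleLaplacian) :=
    assemble_comp (fun w => Sum.map (cell w) fun k => (k, w)) gadget triangleLaplacian
  let D' : Matrix (Fin 4) (Fin 4) ℚ :=
    (1 / 36 : ℚ) • !![10, 1, 1, 2; 1, 10, 1, 2; 1, 1, 10, 2; 2, 2, 2, 4]
  let B : Matrix (Fin 3) (Fin 4) ℚ := !![0, -1, -1, -2; -1, 0, -1, -2; -1, -1, 0, -2]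
  let D : Matrix (Fin 4) (Fin 4) ℚ := !![4, 0, 0, -2; 0, 4, 0, -2; 0, 0, 4, -2; -2, -2, -2, 12]
  have hD : D' * D = 1 := by
    decide +kernel
  have hdet : D.det = 576 := by
    decide +kernel
  have hS : 4 - B * D' * Bᵀ = (5 / 4 : ℚ) • triangleLaplacian.map (Int.castRingHom ℚ) := by
    decide +kernel
  have h2 : (assemble gadget triangleLaplacian).map (Int.castRingHom ℚ) =
      fromBlocks 4 B Bᵀ D := by
    rw [assemble_gadget, fromBlocks_map]
    congr 1
    · ext i j
      fin_cases i <;> fin_cases j <;> rfl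
    · ext i j
      fin_cases i <;> fin_cases j <;> simp [B]
    · ext i j
      fin_cases i <;> fin_cases j <;> simp [B]
    · ext i j
      fin_cases i <;> fin_cases j <;> simp [D]
  have h3 : triangleLaplacian.map (Int.castRingHom ℚ) *ᵥ 1 = 0 := by
    ext i
    fin_cases i <;> simp [triangleLaplacian, mulVec, dotProduct, Fin.sum_univ_three] <;> norm_num
  rw [h1, intCast_det_assemble_add_single, intCast_det_assemble_add_single, h2,
    det_assemble_fromBlocks cell _ _ _ D' hD, hdet, hS,
    assemble_smul, det_smul_add_single_of_mulVec_one _ (assemble_mulVec_one _ _ h3) r (by norm_num),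
    mul_assoc]

end NonPCFGasket

/-! ### The geometry of the contractions -/

namespace NonPCFGasket

open Matrix SelfSimilar

theorem sum_bary (p : EuclideanSpace ℝ (Fin 2)) : ∑ i, bary p i = 1 := by
  simp [bary, Fin.sum_univ_three]
  ring

theorem sum_bary_smul_vertex (p : EuclideanSpace ℝ (Fin 2)) : ∑ i, bary p i • vertex i = p := by
  have h : √3 ≠ 0 := by positivity
  ext k
  fin_cases k
  · simp [bary, vertex, Fin.sum_univ_three]
    field_simp
    ring
  · simp [bary, vertex, Fin.sum_univ_three]
    field_simp

theorem bary_sum_smul_vertex (d : Fin 3 → ℝ) (hd : ∑ i, d i = 1) :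
    bary (∑ i, d i • vertex i) = d := by
  have h : √3 ≠ 0 := by positivity
  rw [Fin.sum_univ_three] at hd
  ext k
  fin_cases k
  · simp [bary, vertex, Fin.sum_univ_three]
    field_simp
    linarith
  · simp [bary, vertex, Fin.sum_univ_three]
    field_simp
    ring
  · simp [bary, vertex, Fin.sum_univ_three]
    field_simp

theorem bary_injective : Function.Injective bary := fun p q h => by
  rw [← sum_bary_smul_vertex p, h, sum_bary_smul_vertex]

theorem bary_vertex (i : Fin 3) : bary (vertex i) = Pi.single i 1 := by
  have h := bary_sum_smul_vertex (Pi.single i 1) (by simp)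
  rwa [Finset.sum_eq_single i (fun j _ hj => by simp [hj]) (by simp), Pi.single_eq_same,
    one_smul] at h

theorem bary_triangleSymm (σ : Equiv.Perm (Fin 3)) (p : EuclideanSpace ℝ (Fin 2)) (i : Fin 3) :
    bary (triangleSymm σ p) (σ i) = bary p i := by
  have h : triangleSymm σ p = ∑ j, bary p (σ⁻¹ j) • vertex j := by
    rw [triangleSymm, ← Equiv.sum_comp σ fun j => bary p (σ⁻¹ j) • vertex j]
    simp
  rw [h, bary_sum_smul_vertex]
  · simp
  · rw [Equiv.sum_comp σ⁻¹ (bary p), sum_bary]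

theorem bary_baseMap (p : EuclideanSpace ℝ (Fin 2)) :
    bary (baseMap p) = ![bary p 0 + 5 / 12 * bary p 1 + 1 / 3 * bary p 2,
      5 / 12 * bary p 1 + 1 / 3 * bary p 2, 1 / 6 * bary p 1 + 1 / 3 * bary p 2] := by
  have h : √3 ≠ 0 := by positivity
  have h3 : √3 ^ 2 = 3 := Real.sq_sqrt (by norm_num)
  ext k
  fin_cases k <;> simp [bary, baseMap] <;> field_simp <;> ring_nf <;> simp only [h3] <;> ring

theorem bary_contraction (σ : Equiv.Perm (Fin 3)) (p : EuclideanSpace ℝ (Fin 2)) (i : Fin 3) :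
    bary (contraction σ p) (σ i) =
      ![bary p (σ 0) + 5 / 12 * bary p (σ 1) + 1 / 3 * bary p (σ 2),
        5 / 12 * bary p (σ 1) + 1 / 3 * bary p (σ 2),
        1 / 6 * bary p (σ 1) + 1 / 3 * bary p (σ 2)] i := by
  have h : ∀ j, bary (triangleSymm σ⁻¹ p) j = bary p (σ j) := fun j => by
    simpa using bary_triangleSymm σ⁻¹ p (σ j)
  rw [contraction, bary_triangleSymm, bary_baseMap]
  simp only [h]

/-- Barycentric coordinates determine a point; in them the six maps have rational coefficients and
differ only by relabelling. -/
theorem contraction_eq_iff (σ : Equiv.Perm (Fin 3)) (p q : EuclideanSpace ℝ (Fin 2)) :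
    contraction σ p = q ↔
      bary q (σ 0) = bary p (σ 0) + 5 / 12 * bary p (σ 1) + 1 / 3 * bary p (σ 2) ∧
      bary q (σ 1) = 5 / 12 * bary p (σ 1) + 1 / 3 * bary p (σ 2) ∧
      bary q (σ 2) = 1 / 6 * bary p (σ 1) + 1 / 3 * bary p (σ 2) := by
  have h := bary_contraction σ p
  constructor
  · rintro rfl
    exact ⟨h 0, h 1, h 2⟩
  · rintro ⟨h0, h1, h2⟩
    refine bary_injective (funext fun j => ?_)
    obtain ⟨i, rfl⟩ := σ.surjective j
    rw [h]
    fin_cases i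
    · exact h0.symm
    · exact h1.symm
    · exact h2.symm

theorem contraction_injective (σ : Equiv.Perm (Fin 3)) :
    Function.Injective (contraction σ) := by
  intro p q hpq
  obtain ⟨h0, h1, h2⟩ := (contraction_eq_iff σ p _).1 hpq
  obtain ⟨h0', h1', h2'⟩ := (contraction_eq_iff σ q _).1 rfl
  refine bary_injective (funext fun j => ?_)
  obtain ⟨i, rfl⟩ := σ.surjective j
  fin_cases i
  · change bary p (σ 0) = bary q (σ 0)
    linarith
  · change bary p (σ 1) = bary q (σ 1)
    linarith
  · change bary p (σ 2) = bary q (σ 2)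
    linarith

theorem contraction_vertex_zero (σ : Equiv.Perm (Fin 3)) :
    contraction σ (vertex (σ 0)) = vertex (σ 0) := by
  rw [contraction_eq_iff]
  simp [bary_vertex]

theorem boundary_contraction : boundary contraction = Set.range vertex := by
  ext p
  constructor
  · rintro ⟨σ, h⟩
    obtain ⟨h0, h1, h2⟩ := (contraction_eq_iff σ p p).1 h
    have h1' : bary p (σ 1) = 0 := by linarith
    have h2' : bary p (σ 2) = 0 := by linarith
    refine ⟨σ 0, bary_injective (funext fun j => ?_)⟩
    have hs : bary p (σ 0) = 1 := by
      have := sum_bary p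
      rw [← Equiv.sum_comp σ, Fin.sum_univ_three] at this
      linarith
    obtain ⟨i, rfl⟩ := σ.surjective j
    fin_cases i <;> simp [bary_vertex, h1', h2', hs]
  · rintro ⟨i, rfl⟩
    refine ⟨Equiv.swap 0 i, ?_⟩
    have := contraction_vertex_zero (Equiv.swap 0 i)
    rwa [Equiv.swap_apply_left] at this

/-- The new vertices in the triangle: the centre for the index `3`, and the common vertex of the two
pieces at the side opposite to the vertex `k` for the other indices. -/
noncomputable def newVertex (k : Fin 4) : EuclideanSpace ℝ (Fin 2) :=
  ∑ i : Fin 3, (if k = 3 then 1 / 3 else if k = i.castSucc then 1 / 6 else 5 / 12 : ℝ) • vertex i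

theorem bary_newVertex (k : Fin 4) (i : Fin 3) : bary (newVertex k) i =
    if k = 3 then 1 / 3 else if k = i.castSucc then 1 / 6 else 5 / 12 := by
  rw [newVertex, bary_sum_smul_vertex]
  fin_cases k <;> norm_num [Fin.sum_univ_three, Fin.ext_iff]

theorem newVertex_injective : Function.Injective newVertex := by
  intro k l h
  have h' := fun i => congrArg (fun p => bary p i) h
  simp only [bary_newVertex] at h'
  have h0 := h' 0
  have h1 := h' 1
  have h2 := h' 2
  clear h h'
  fin_cases k <;> fin_cases l <;> first | rfl | (revert h0 h1 h2; norm_num [Fin.ext_iff])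

/-- This identifies the geometric pieces with the combinatorial `gadget`. -/
theorem contraction_vertex (σ : Equiv.Perm (Fin 3)) (j : Fin 3) :
    contraction σ (vertex j) = Sum.elim vertex newVertex (gadget σ j) := by
  obtain ⟨i, rfl⟩ := σ.surjective j
  have hne : ∀ a b : Fin 3, a ≠ b → (σ a).castSucc ≠ (σ b).castSucc := fun a b hab h =>
    hab (σ.injective (Fin.castSucc_injective _ h))
  fin_cases i
  · simp [gadget, contraction_vertex_zero]
  · have h3 : (σ 2).castSucc ≠ 3 := (Fin.castSucc_lt_last _).ne
    simp [gadget, contraction_eq_iff, bary_vertex, bary_newVertex, h3]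
  · simp [gadget, contraction_eq_iff, bary_vertex, bary_newVertex]

/-- The order of the barycentric coordinates determines the piece of a point. -/
theorem perm_eq_of_le_of_lt {σ τ : Equiv.Perm (Fin 3)} {y : Fin 3 → ℝ}
    (h1 : y (σ 1) ≤ y (σ 0)) (h2 : y (σ 2) ≤ y (σ 1))
    (h3 : y (τ 1) < y (τ 0)) (h4 : y (τ 2) < y (τ 1)) : σ = τ := by
  have hσ : Antitone (y ∘ σ) := Fin.antitone_iff_succ_le.2 fun i => by
    fin_cases i
    · exact h1
    · exact h2
  have hτ : StrictAnti (y ∘ τ) := Fin.strictAnti_iff_succ_lt.2 fun i => by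
    fin_cases i
    · exact h3
    · exact h4
  -- A monotone permutation of `Fin 3` is the identity.
  have hm : Monotone (σ.trans τ.symm) := fun i j hij => by
    have h := hσ hij
    by_contra! hlt
    have h' := hτ hlt
    simp at h h'
    linarith
  have hm' : StrictMono (σ.trans τ.symm) := hm.strictMono_of_injective (Equiv.injective _)
  have he := (hm'.range_inj strictMono_id).1 (by simp)
  ext i
  have h := congrFun he i
  rw [Equiv.trans_apply, id, Equiv.symm_apply_eq] at h
  rw [h]

theorem wordMap_append (w : List (Equiv.Perm (Fin 3))) (σ : Equiv.Perm (Fin 3))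
    (p : EuclideanSpace ℝ (Fin 2)) :
    wordMap contraction (w ++ [σ]) p = wordMap contraction w (contraction σ p) := by
  induction w with
  | nil => rfl
  | cons τ w ih => exact congrArg (contraction τ) ih

theorem bary_wordMap_nonneg (w : List (Equiv.Perm (Fin 3))) {p : EuclideanSpace ℝ (Fin 2)}
    (hp : ∀ i, 0 ≤ bary p i) (i : Fin 3) : 0 ≤ bary (wordMap contraction w p) i := by
  induction w generalizing i with
  | nil => exact hp i
  | cons σ w ih =>
    obtain ⟨j, rfl⟩ := σ.surjective i
    have h0 := ih (σ 0)
    have h1 := ih (σ 1)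
    have h2 := ih (σ 2)
    change 0 ≤ bary (contraction σ (wordMap contraction w p)) (σ j)
    rw [bary_contraction]
    fin_cases j <;> simp <;> linarith

theorem bary_wordMap_pos (w : List (Equiv.Perm (Fin 3))) {p : EuclideanSpace ℝ (Fin 2)}
    (hp : ∀ i, 0 < bary p i) (i : Fin 3) : 0 < bary (wordMap contraction w p) i := by
  induction w generalizing i with
  | nil => exact hp i
  | cons σ w ih =>
    obtain ⟨j, rfl⟩ := σ.surjective i
    have h0 := ih (σ 0)
    have h1 := ih (σ 1)
    have h2 := ih (σ 2)
    change 0 < bary (contraction σ (wordMap contraction w p)) (σ j)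
    rw [bary_contraction]
    fin_cases j <;> simp <;> linarith

/-- The open set condition, in the form that a cell does not meet the interior of a different
cell of the same level. -/
theorem wordMap_eq_wordMap {u w : List (Equiv.Perm (Fin 3))} (hl : u.length = w.length)
    {p q : EuclideanSpace ℝ (Fin 2)} (hp : ∀ i, 0 ≤ bary p i) (hq : ∀ i, 0 < bary q i)
    (h : wordMap contraction u p = wordMap contraction w q) : u = w ∧ p = q := by
  induction u generalizing w with
  | nil =>
    obtain rfl := List.length_eq_zero_iff.1 hl.symm
    exact ⟨rfl, h⟩
  | cons σ u ih =>
    obtain ⟨τ, w, rfl⟩ := List.exists_cons_of_length_eq_add_one hl.symm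
    change contraction σ (wordMap contraction u p) = contraction τ (wordMap contraction w q) at h
    obtain ⟨h0, h1, h2⟩ := (contraction_eq_iff σ _ _).1 h
    obtain ⟨h0', h1', h2'⟩ :=
      (contraction_eq_iff τ (wordMap contraction w q) _).1 rfl
    have hu := bary_wordMap_nonneg u hp
    have hw := bary_wordMap_pos w hq
    -- In the image under `contraction σ` the successive coordinate differences are `bary p (σ 0)`
    -- and `bary p (σ 1) / 4`: nonnegative on the closed triangle, positive inside.
    obtain rfl : σ = τ := perm_eq_of_le_of_lt
      (y := bary (contraction τ (wordMap contraction w q)))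
      (by linarith [hu (σ 0)]) (by linarith [hu (σ 1)])
      (by linarith [hw (τ 0)]) (by linarith [hw (τ 1)])
    obtain ⟨rfl, hpq⟩ := ih (by simpa using hl) (contraction_injective σ h)
    exact ⟨rfl, hpq⟩

theorem bary_vertex_nonneg (j i : Fin 3) : 0 ≤ bary (vertex j) i := by
  rw [bary_vertex]
  by_cases h : i = j <;> simp [h]

theorem bary_newVertex_pos (k : Fin 4) (i : Fin 3) : 0 < bary (newVertex k) i := by
  rw [bary_newVertex]
  split_ifs <;> norm_num

theorem vertex_injective : Function.Injective vertex := fun i j h => by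
  have := congrFun (congrArg bary h) i
  rw [bary_vertex, bary_vertex] at this
  by_contra hne
  simp [hne] at this

theorem vertex_ne_newVertex (j : Fin 3) (k : Fin 4) : vertex j ≠ newVertex k := fun h => by
  have h1 := bary_newVertex_pos k (j + 1)
  rw [← h, bary_vertex] at h1
  simp at h1

end NonPCFGasket

/-! ### The approximating graphs -/

namespace NonPCFGasket

open Matrix SelfSimilar

/-- A description of the cells and the vertices of the graph of level `n`: the cell `w` has the
address `word w` and the vertices `cell w i`. -/
structure CellStructure (n : ℕ) (V W : Type) where
  word : W → List (Equiv.Perm (Fin 3))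
  point : V → EuclideanSpace ℝ (Fin 2)
  cell : W → Fin 3 → V
  word_injective : Function.Injective word
  range_word : Set.range word = {l | l.length = n}
  point_injective : Function.Injective point
  point_cell : ∀ w i, point (cell w i) = wordMap contraction (word w) (vertex i)
  exists_cell : ∀ v, ∃ w i, cell w i = v

namespace CellStructure

/-- The single cell of level `0`. -/
noncomputable def zero : CellStructure 0 (Fin 3) Unit where
  word _ := []
  point := vertex
  cell _ i := i
  word_injective _ _ _ := rfl
  range_word := by
    ext l
    refine ⟨?_, fun h => ⟨(), (List.length_eq_zero_iff.1 h).symm⟩⟩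
    rintro ⟨-, rfl⟩
    rfl
  point_injective := vertex_injective
  point_cell _ _ := rfl
  exists_cell v := ⟨(), v, rfl⟩

variable {n : ℕ} {V W : Type} (c : CellStructure n V W)

theorem length_word (w : W) : (c.word w).length = n := by
  have h : c.word w ∈ {l : List (Equiv.Perm (Fin 3)) | l.length = n} :=
    c.range_word ▸ Set.mem_range_self w
  exact h

/-- The points of the next level. -/
noncomputable def nextPoint : V ⊕ Fin 4 × W → EuclideanSpace ℝ (Fin 2) :=
  Sum.elim c.point fun x => wordMap contraction (c.word x.2) (newVertex x.1)

/-- New points are interior to their cells, so they differ from all old points, which are corners of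
cells, and from the new points of other cells. -/
theorem nextPoint_injective : Function.Injective c.nextPoint := by
  have hne : ∀ v k w, c.point v ≠ wordMap contraction (c.word w) (newVertex k) := by
    intro v k w h
    obtain ⟨u, i, rfl⟩ := c.exists_cell v
    rw [c.point_cell] at h
    exact vertex_ne_newVertex i k (wordMap_eq_wordMap ((c.length_word u).trans
      (c.length_word w).symm) (bary_vertex_nonneg i) (bary_newVertex_pos k) h).2
  rintro (v | ⟨k, w⟩) (v' | ⟨k', w'⟩) h
  · exact congrArg Sum.inl (c.point_injective h)
  · exact absurd h (hne v k' w')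
  · exact absurd h.symm (hne v' k w)
  · obtain ⟨h1, h2⟩ := wordMap_eq_wordMap ((c.length_word w).trans
      (c.length_word w').symm) (fun i => (bary_newVertex_pos k i).le) (bary_newVertex_pos k') h
    rw [c.word_injective h1, newVertex_injective h2]

theorem nextPoint_subdivide (x : W × Equiv.Perm (Fin 3)) (i : Fin 3) :
    c.nextPoint (subdivide c.cell x i) =
      wordMap contraction (c.word x.1 ++ [x.2]) (vertex i) := by
  rw [wordMap_append, contraction_vertex, subdivide, Function.comp_apply]
  cases gadget x.2 i with
  | inl j => exact c.point_cell _ _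
  | inr k => rfl

theorem gadget_surjective (a : Fin 3 ⊕ Fin 4) : ∃ σ i, gadget σ i = a := by
  revert a
  decide +kernel

/-- The passage to the next level. -/
noncomputable def succ : CellStructure (n + 1) (V ⊕ Fin 4 × W) (W × Equiv.Perm (Fin 3)) where
  word x := c.word x.1 ++ [x.2]
  point := c.nextPoint
  cell := subdivide c.cell
  word_injective := by
    rintro ⟨w, σ⟩ ⟨w', σ'⟩ h
    obtain ⟨h1, h2⟩ := List.append_inj' h rfl
    exact Prod.ext (c.word_injective h1) (List.head_eq_of_cons_eq h2)
  range_word := by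
    ext l
    constructor
    · rintro ⟨x, rfl⟩
      simp [c.length_word]
    · intro hl
      have hl : l.length = n + 1 := hl
      have hne : l ≠ [] := fun h => by simp [h] at hl
      have h : l.dropLast ∈ Set.range c.word := by
        rw [c.range_word]
        simp [hl]
      obtain ⟨w, hw⟩ := h
      exact ⟨(w, l.getLast hne), by simp [hw, List.dropLast_append_getLast]⟩
  point_injective := c.nextPoint_injective
  point_cell := c.nextPoint_subdivide
  exists_cell := by
    rintro (v | ⟨k, w⟩)
    · obtain ⟨w, i, rfl⟩ := c.exists_cell v
      obtain ⟨σ, j, h⟩ := gadget_surjective (Sum.inl i)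
      exact ⟨(w, σ), j, by simp [subdivide, h]⟩
    · obtain ⟨σ, j, h⟩ := gadget_surjective (Sum.inr k)
      exact ⟨(w, σ), j, by simp [subdivide, h]⟩

theorem range_point : Set.range c.point = V(approxGraph contraction n) := by
  ext x
  constructor
  · rintro ⟨v, rfl⟩
    obtain ⟨w, i, rfl⟩ := c.exists_cell v
    exact ⟨c.word w, c.length_word w, vertex i, boundary_contraction ▸ Set.mem_range_self i,
      (c.point_cell w i).symm⟩
  · rintro ⟨l, hl, p, hp, rfl⟩
    rw [boundary_contraction] at hp
    obtain ⟨i, rfl⟩ := hp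
    obtain ⟨w, rfl⟩ : l ∈ Set.range c.word := c.range_word ▸ hl
    exact ⟨c.cell w i, c.point_cell w i⟩

theorem ncard_vertexSet (c : CellStructure n V W) [Fintype V] :
    V(approxGraph contraction n).ncard = Fintype.card V := by
  rw [← c.range_point, ← Set.image_univ, Set.ncard_image_of_injective _ c.point_injective,
    Set.ncard_univ, Nat.card_eq_fintype_card]

theorem exists_side_of_ne {i j : Fin 3} : i ≠ j → ∃ k : Fin 3, s(k, k + 1) = s(i, j) := by
  revert i j
  decide

theorem isLink_side (e : W × Fin 3) : (approxGraph contraction n).IsLink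
    (c.word e.1, s(vertex e.2, vertex (e.2 + 1))) (c.point (c.cell e.1 e.2))
    (c.point (c.cell e.1 (e.2 + 1))) := by
  refine ⟨c.length_word e.1, fun h => ?_, fun p hp => ?_, ?_⟩
  · have := vertex_injective (Sym2.mk_isDiag_iff.1 h)
    simp at this
  · rw [boundary_contraction]
    rcases Sym2.mem_iff.1 hp with rfl | rfl <;> exact Set.mem_range_self _
  · rw [c.point_cell, c.point_cell, Sym2.map_mk]

/-- The description of the graph of level `n` by its cells. -/
noncomputable def presentation : (approxGraph contraction n).Presentation V (W × Fin 3) where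
  φ := c.point
  ε e := (c.word e.1, s(vertex e.2, vertex (e.2 + 1)))
  s e := c.cell e.1 e.2
  t e := c.cell e.1 (e.2 + 1)
  φ_injective := c.point_injective
  range_φ := c.range_point
  ε_injective := by
    rintro ⟨w, i⟩ ⟨w', i'⟩ h
    obtain ⟨h1, h2⟩ := Prod.mk.inj h
    have h3 : s(i, i + 1) = s(i', i' + 1) := Sym2.map.injective vertex_injective h2
    have h4 : ∀ i i' : Fin 3, s(i, i + 1) = s(i', i' + 1) → i = i' := by decide
    exact Prod.ext (c.word_injective h1) (h4 i i' h3)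
  range_ε := by
    ext ⟨l, z⟩
    constructor
    · rintro ⟨e, he⟩
      exact he ▸ (c.isLink_side e).edge_mem
    · intro h
      obtain ⟨x, y, hl, hd, hb, -⟩ := Graph.exists_isLink_of_mem_edgeSet h
      obtain ⟨w, rfl⟩ : l ∈ Set.range c.word := c.range_word ▸ hl
      induction z using Sym2.ind with
      | _ p q =>
        rw [boundary_contraction] at hb
        obtain ⟨i, rfl⟩ := hb p (Sym2.mem_mk_left _ _)
        obtain ⟨j, rfl⟩ := hb q (Sym2.mem_mk_right _ _)
        obtain ⟨k, hk⟩ := exists_side_of_ne fun hij : i = j => hd (hij ▸ Sym2.mk_isDiag_iff.2 rfl)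
        exact ⟨(w, k), Prod.ext rfl (congrArg (Sym2.map vertex) hk)⟩
  isLink := c.isLink_side

theorem complexity_eq [Fintype V] [DecidableEq V] [Fintype W] (r : V) :
    ((approxGraph contraction n).complexity : ℤ) =
      (assemble c.cell triangleLaplacian + single r r 1).det := by
  rw [c.presentation.complexity_eq_det r]
  exact congrArg Matrix.det (rootedIncidence_mul_transpose c.cell r)

theorem complexity_succ (c : CellStructure n V W) [Fintype V] [Nonempty V] [Fintype W] :
    ((approxGraph contraction (n + 1)).complexity : ℚ) =
      576 ^ Fintype.card W * (5 / 4) ^ (Fintype.card V - 1) *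
        ((approxGraph contraction n).complexity : ℚ) := by
  classical
  let r := Classical.arbitrary V
  have h := det_subdivide c.cell r
  have h' : ((approxGraph contraction (n + 1)).complexity : ℤ) =
      (assemble (subdivide c.cell) triangleLaplacian + single (Sum.inl r) (Sum.inl r) 1).det :=
    c.succ.complexity_eq (Sum.inl r)
  rw [← c.complexity_eq r, ← h'] at h
  exact_mod_cast h

end CellStructure

theorem complexity_zero : (approxGraph contraction 0).complexity = 3 := by
  have h := CellStructure.zero.complexity_eq 0
  have h1 : (assemble CellStructure.zero.cell triangleLaplacian + single 0 0 1).det = 3 := by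
    change (assemble (fun (_ : Unit) (i : Fin 3) => i) triangleLaplacian + single 0 0 1).det = 3
    decide +kernel
  rw [h1] at h
  exact_mod_cast h

/-- The index types change with the level, so they are carried through the induction. The
coefficients are the sums over `k < n` of `6 ^ k` and of `|Vₖ| - 1 = (4 * 6 ^ k + 6) / 5`. -/
theorem card_and_log_complexity (n : ℕ) : ∃ (V W : Type) (_ : Fintype V) (_ : Fintype W),
    Nonempty (CellStructure n V W) ∧ Nonempty V ∧ Fintype.card W = 6 ^ n ∧
      5 * Fintype.card V = 4 * 6 ^ n + 11 ∧ 0 < (approxGraph contraction n).complexity ∧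
      Real.log (approxGraph contraction n).complexity =
        Real.log 3 + (6 ^ n - 1) / 5 * Real.log 576 +
          (4 * (6 ^ n - 1) / 25 + 6 * n / 5) * Real.log (5 / 4) := by
  induction n with
  | zero =>
    refine ⟨Fin 3, Unit, inferInstance, inferInstance, ⟨.zero⟩, inferInstance, rfl, rfl, ?_, ?_⟩
    · simp [complexity_zero]
    · simp [complexity_zero]
  | succ n ih =>
    obtain ⟨V, W, _, _, ⟨c⟩, _, hW, hV, hpos, hlog⟩ := ih
    have hc := c.complexity_succ
    have hc' : ((approxGraph contraction (n + 1)).complexity : ℝ) =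
        576 ^ Fintype.card W * (5 / 4) ^ (Fintype.card V - 1) *
          ((approxGraph contraction n).complexity : ℝ) := by
      have h := congrArg (fun q : ℚ => (q : ℝ)) hc
      push_cast at h
      exact h
    have hpos' : (0 : ℝ) < (approxGraph contraction n).complexity := by exact_mod_cast hpos
    have hV' : ((Fintype.card V - 1 : ℕ) : ℝ) = (4 * 6 ^ n + 6) / 5 := by
      have h1 : 5 * (Fintype.card V - 1) = 4 * 6 ^ n + 6 := by lia
      have h2 : (5 : ℝ) * ((Fintype.card V - 1 : ℕ) : ℝ) = 4 * 6 ^ n + 6 := by exact_mod_cast h1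
      linarith
    refine ⟨V ⊕ Fin 4 × W, W × Equiv.Perm (Fin 3), inferInstance, inferInstance, ⟨c.succ⟩,
      inferInstance, ?_, ?_, ?_, ?_⟩
    · rw [Fintype.card_prod, hW, Fintype.card_perm, Fintype.card_fin, pow_succ]
      rfl
    · rw [Fintype.card_sum, Fintype.card_prod, hW, Fintype.card_fin, mul_add, hV]
      ring
    · have : (0 : ℝ) < (approxGraph contraction (n + 1)).complexity := hc' ▸ by positivity
      exact_mod_cast this
    · rw [hc', Real.log_mul (by positivity) hpos'.ne', Real.log_mul (by positivity) (by positivity),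
        Real.log_pow, Real.log_pow, hV', hlog, hW]
      push_cast
      ring

theorem card_vertexSet (n : ℕ) :
    (V(approxGraph contraction n).ncard : ℝ) = (4 * 6 ^ n + 11) / 5 := by
  obtain ⟨V, W, _, _, ⟨c⟩, _, -, hV, -⟩ := card_and_log_complexity n
  rw [c.ncard_vertexSet]
  have : (5 : ℝ) * Fintype.card V = 4 * 6 ^ n + 11 := by exact_mod_cast hV
  linarith

theorem log_complexity (n : ℕ) :
    Real.log (approxGraph contraction n).complexity =
      Real.log 3 + (6 ^ n - 1) / 5 * Real.log 576 +
        (4 * (6 ^ n - 1) / 25 + 6 * n / 5) * Real.log (5 / 4) := by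
  obtain ⟨V, W, _, _, -, -, -, -, -, h⟩ := card_and_log_complexity n
  exact h

/-- After division by `6 ^ n` only `b / 5 + 4 * c / 25` survives above and `4 / 5` below. -/
theorem tendsto_log_ratio (a b c : ℝ) :
    Tendsto (fun n : ℕ => (a + (6 ^ n - 1) / 5 * b + (4 * (6 ^ n - 1) / 25 + 6 * n / 5) * c) /
      ((4 * 6 ^ n + 11) / 5)) atTop (𝓝 (b / 4 + c / 5)) := by
  have h1 : Tendsto (fun n : ℕ => ((1 / 6 : ℝ)) ^ n) atTop (𝓝 0) :=
    tendsto_pow_atTop_nhds_zero_of_lt_one (by norm_num) (by norm_num)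
  have h2 : Tendsto (fun n : ℕ => (n : ℝ) * (1 / 6 : ℝ) ^ n) atTop (𝓝 0) :=
    tendsto_self_mul_const_pow_of_lt_one (by norm_num) (by norm_num)
  have h3 : Tendsto (fun n : ℕ => (a * (1 / 6 : ℝ) ^ n + (1 - (1 / 6 : ℝ) ^ n) / 5 * b +
      (4 * (1 - (1 / 6 : ℝ) ^ n) / 25 + 6 * (n * (1 / 6 : ℝ) ^ n) / 5) * c) /
        ((4 + 11 * (1 / 6 : ℝ) ^ n) / 5)) atTop
      (𝓝 ((a * 0 + (1 - 0) / 5 * b + (4 * (1 - 0) / 25 + 6 * 0 / 5) * c) /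
        ((4 + 11 * 0) / 5))) := by
    refine Tendsto.div ?_ ((tendsto_const_nhds.add (h1.const_mul 11)).div_const 5) (by norm_num)
    refine ((h1.const_mul a).add (((tendsto_const_nhds.sub h1).div_const 5).mul_const b)).add ?_
    exact (((((tendsto_const_nhds.sub h1).const_mul 4).div_const 25).add
      ((h2.const_mul 6).div_const 5)).mul_const c)
  have h4 : (a * 0 + (1 - 0) / 5 * b + (4 * (1 - 0) / 25 + 6 * 0 / 5) * c) /
      ((4 + 11 * 0) / 5) = b / 4 + c / 5 := by ring
  rw [h4] at h3
  refine h3.congr fun n => ?_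
  have h6 : (6 : ℝ) ^ n ≠ 0 := by positivity
  rw [one_div, inv_pow]
  field_simp

end NonPCFGasket

theorem mainTheorem9 :
    Graph.IsAsymptoticComplexityConstant
      (fun n => SelfSimilar.approxGraph NonPCFGasket.contraction n)
      (11 * Real.log 2 / 10 + Real.log 3 / 2 + Real.log 5 / 5) := by
  have h576 : Real.log 576 = 6 * Real.log 2 + 2 * Real.log 3 := by
    rw [show (576 : ℝ) = 2 ^ 6 * 3 ^ 2 by norm_num, Real.log_mul (by norm_num) (by norm_num),
      Real.log_pow, Real.log_pow]
    norm_num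
  have h54 : Real.log (5 / 4) = Real.log 5 - 2 * Real.log 2 := by
    rw [Real.log_div (by norm_num) (by norm_num), show (4 : ℝ) = 2 ^ 2 by norm_num, Real.log_pow]
    norm_num
  have h := NonPCFGasket.tendsto_log_ratio (Real.log 3) (Real.log 576) (Real.log (5 / 4))
  rw [show Real.log 576 / 4 + Real.log (5 / 4) / 5 =
    11 * Real.log 2 / 10 + Real.log 3 / 2 + Real.log 5 / 5 by rw [h576, h54]; ring] at h
  refine h.congr fun n => ?_
  rw [NonPCFGasket.card_vertexSet, NonPCFGasket.log_complexity]
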